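/- Let $I$ be an infinite set and let $P$ be the poset of finite subsets of $I$ ordered by reverse inclusion ($p \le q$ iff $q \subseteq p$), regarded as a category with a unique morphism $p \to q$ whenever $p \le q$. Let $X$ be the poset of filters on $P$ (nonempty, downward directed, upward closed subsets), ordered by inclusion, and put $\mathbf{p} = |P|$. Grothendieck topologies $J$ on $P$ are identified with the subtoposes $\mathsf{Sh}(P,J) \subseteq \mathsf{PSh}(P)$. Let $\mathbf{gt}$ be the number of Grothendieck topologies on $P$, and let $\mathbf{cl}$, $\mathbf{coh}$, $\mathbf{ep}$ be the numbers of those $J$ for which $\mathsf{Sh}(P,J)$ is, respectively, a closed subtopos of $\mathsf{PSh}(P)$, a coherent subtopos of $\mathsf{PSh}(P)$, a topos with enough points. Here: - $\mathsf{Sh}(P,J)$ is *closed* if there is a subterminal object $U$ of $\mathsf{PSh}(P)$ such that the sheaves are exactly the presheaves $F$ for which the projection $F\times U\to U$ is an isomorphism. - An object of a topos is *compact* if every epimorphic family with that codomain contains a finite epimorphic subfamily; it is *coherent* if it is compact and the pullback of any two maps to it from compact objects is compact. A topos is *coherent* if it has a full subcategory of compact generators that is closed under finite limits. $\mathsf{Sh}(P,J)$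 is a *coherent subtopos* of $\mathsf{PSh}(P)$ if both toposes are coherent and sheafification $\mathsf{PSh}(P)\to\mathsf{Sh}(P,J)$ preserves coherent objects. Then: 1. The map $x \mapsto \bigcup_{p \in x} p$ is an order isomorphism from $X$ to the power set $\mathcal{P}(I)$ ordered by inclusion, and $|X| = 2^{\mathbf{p}}$. 2. $\mathbf{cl} = \mathbf{coh} = 2^{\mathbf{p}}$. 3. $\mathbf{ep} = \mathbf{gt} = 2^{2^{\mathbf{p}}}$. 4. $\mathcal{P}(I)$ contains an antichain (for inclusion) of cardinality $2^{\mathbf{p}}$. 5. Every upward closed subset of $X$ is closed in the strong topology, i.e. the topology on $X$ generated by the sets that are locally closed for the Scott topology. -/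

import Mathlib

open CategoryTheory CategoryTheory.Limits Cardinal Topology

universe w v u

/-! ### Coherent toposes and coherent subtoposes -/

section Coherent

variable {E : Type w} [Category.{v} E]

/-- The family `f` of morphisms with codomain `X` is epimorphic. -/
def EpimorphicFamily {ι : Type*} {Y : ι → E} {X : E} (f : ∀ i, Y i ⟶ X) : Prop :=
  ∀ ⦃Z : E⦄ (g h : X ⟶ Z), (∀ i, f i ≫ g = f i ≫ h) → g = h

/-- `X` is compact: every epimorphic family with codomain `X` contains a finite epimorphic
subfamily. -/
def IsCompactObject (X : E) : Prop :=
  ∀ ⦃ι : Type v⦄ (Y : ι → E) (f : ∀ i, Y i ⟶ X), EpimorphicFamily f →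
    ∃ s : Finset ι, EpimorphicFamily (fun i : s => f i)

/-- `X` is coherent: it is compact, and the pullback of any two morphisms from compact objects
to `X` is compact. -/
def IsCoherentObject (X : E) : Prop :=
  IsCompactObject X ∧
    ∀ ⦃Q Y Z : E⦄ (a : Q ⟶ Y) (b : Q ⟶ Z) (f : Y ⟶ X) (g : Z ⟶ X),
      IsPullback a b f g → IsCompactObject Y → IsCompactObject Z → IsCompactObject Q

variable (E) in
/-- The topos `E` is coherent: it has a full subcategory `K` of compact generators which is
closed under finite limits. -/
def IsCoherentTopos : Prop :=
  ∃ K : ObjectProperty E,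
    (∀ X, K X → IsCompactObject X) ∧
    K.IsSeparating ∧
    ∀ (D : Type) [SmallCategory D] [FinCategory D], K.IsClosedUnderLimitsOfShape D

end Coherent

section Subtopos

variable {C : Type u} [SmallCategory C]

/-- The subtopos `Sh(C, J)` of `PSh(C)` is a coherent subtopos: `PSh(C)` and `Sh(C, J)` are coherent
toposes, and the inverse image functor of the inclusion, which is sheafification, preserves
coherent objects. -/
def IsCoherentSubtopos (J : GrothendieckTopology C) : Prop :=
  IsCoherentTopos (Cᵒᵖ ⥤ Type u) ∧ IsCoherentTopos (Sheaf J (Type u)) ∧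
    ∀ F : Cᵒᵖ ⥤ Type u, IsCoherentObject F →
      IsCoherentObject ((presheafToSheaf J (Type u)).obj F)

/-- The subtopos `Sh(C, J)` of `PSh(C)` is a closed subtopos: it is the closed complement of the
open subtopos given by some subterminal object `U`, that is, its objects are the presheaves `F`
for which the projection `F × U ⟶ U` is an isomorphism. -/
def IsClosedSubtopos (J : GrothendieckTopology C) : Prop :=
  ∃ U : Cᵒᵖ ⥤ Type u, Mono (terminal.from U) ∧
    ∀ F : Cᵒᵖ ⥤ Type u, Presheaf.IsSheaf J F ↔ IsIso (prod.snd : F ⨯ U ⟶ U)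

end Subtopos

/-- The strong topology associated to a topology `t` on `X`: its basis is formed by the sets that are
locally closed for `t`. -/
abbrev strongTopology {X : Type*} (t : TopologicalSpace X) : TopologicalSpace X :=
  TopologicalSpace.generateFrom {s | @IsLocallyClosed X t s}

/-- The poset of finite subsets of `I` under reverse inclusion, viewed as a category with a unique
morphism `p ⟶ q` whenever `p ≤ q`. -/
abbrev FinSubsetsRev (I : Type u) : Type u := (Finset I)ᵒᵈ

/-!
A set of filters on `P` induces a topology with enough points, and pairwise incomparable filters can
be recovered from the topology that they induce. As the filters on `P` form a power set `𝒫(I)`,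
which contains an antichain of cardinality `2 ^ 𝐩`, this produces `2 ^ 2 ^ 𝐩` topologies with enough
points, and there are not more topologies than that.

Closed subtoposes correspond to subterminal presheaves, that is, to lower sets of `P`. Coherent
subtoposes correspond to topologies of finite type, in which every covering sieve contains a
finitely generated one. Such a topology is determined by its finitely generated covering sieves, so
there are at most `2 ^ 𝐩` of them. When `J` has finite type, a sheaf is compact exactly when
finitely many of its sections generate it locally, and coherence reduces to a condition on fibre
products of representables; conversely, compactness of the sheaf associated to a representable makes
every covering sieve finitely generated up to refinement.
-/

section FiniteSubsets

variable {I : Type u}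

theorem mem_pfilter_finSubsetsRev_iff (x : Order.PFilter (FinSubsetsRev I)) (p : FinSubsetsRev I) :
    p ∈ x ↔ ∀ i ∈ OrderDual.ofDual p, ∃ q ∈ x, i ∈ OrderDual.ofDual q := by
  classical
  refine ⟨fun hp i hi => ⟨p, hp, hi⟩, fun h => ?_⟩
  have hsingle : ∀ i ∈ OrderDual.ofDual p, OrderDual.toDual {i} ∈ x := fun i hi =>
    let ⟨_, hq, hiq⟩ := h i hi
    Order.PFilter.mem_of_le (Finset.singleton_subset_iff.2 hiq) hq
  rw [← OrderDual.toDual_ofDual p, ← Finset.sup_singleton_eq_self (OrderDual.ofDual p)]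
  exact (Order.Ideal.finsetSup_mem_iff x.dual).2 hsingle

/-- The filter of finite subsets of `A`. -/
def finSubsetsPFilter (A : Set I) : Order.PFilter (FinSubsetsRev I) :=
  Order.IsPFilter.toPFilter (F := {p : FinSubsetsRev I | ↑(OrderDual.ofDual p) ⊆ A})
    (by
      classical
      refine .of_def ⟨OrderDual.toDual ∅, by simp⟩ (fun p hp q hq => ⟨p ⊓ q, ?_, ?_⟩)
        fun hpq hp => (Finset.coe_subset.2 hpq).trans hp
      · exact (Finset.coe_union _ _).trans_subset (Set.union_subset hp hq)
      · exact ⟨inf_le_left, inf_le_right⟩)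

/-- Filters of finite subsets of `I` under reverse inclusion correspond to subsets of `I`. -/
def pfilterFinSubsetsRevIso (I : Type u) : Order.PFilter (FinSubsetsRev I) ≃o Set I where
  toFun x := {i | ∃ p ∈ x, i ∈ OrderDual.ofDual p}
  invFun := finSubsetsPFilter
  left_inv x := SetLike.ext fun p => (mem_pfilter_finSubsetsRev_iff x p).symm
  right_inv A := by
    refine Set.Subset.antisymm (fun i ⟨_, hp, hi⟩ => hp hi) fun i hi => ?_
    refine ⟨OrderDual.toDual {i}, ?_, Finset.mem_singleton_self i⟩
    exact (Finset.coe_singleton i).trans_subset (Set.singleton_subset_iff.2 hi)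
  map_rel_iff' {x y} :=
    ⟨fun h p hp => (mem_pfilter_finSubsetsRev_iff y p).2 fun _ hi => h ⟨p, hp, hi⟩,
      fun h _ ⟨p, hp, hi⟩ => ⟨p, h hp, hi⟩⟩

variable [Infinite I]

instance : Infinite (FinSubsetsRev I) :=
  inferInstanceAs (Infinite (Finset I))

variable (I)

theorem mk_finSubsetsRev : #(FinSubsetsRev I) = #I :=
  mk_finset_of_infinite I

theorem mk_pfilter_finSubsetsRev :
    #(Order.PFilter (FinSubsetsRev I)) = (2 : Cardinal.{u}) ^ #(FinSubsetsRev I) := by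
  rw [mk_congr (pfilterFinSubsetsRevIso I).toEquiv, mk_set, mk_finSubsetsRev]

end FiniteSubsets

section Antichain

/-- The disjoint union of `B` and its complement: an encoding of the subsets of `I` as pairwise
incomparable subsets of `I ⊕ I`. -/
def disjSumCompl {I : Type*} (B : Set I) : Set (I ⊕ I) :=
  {x | Sum.elim (· ∈ B) (· ∉ B) x}

theorem disjSumCompl_subset_disjSumCompl_iff {I : Type*} {B C : Set I} :
    disjSumCompl B ⊆ disjSumCompl C ↔ B = C := by
  refine ⟨fun h => Set.Subset.antisymm (fun i hi => h (a := .inl i) hi) fun i hi => ?_,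
    fun h => h ▸ subset_rfl⟩
  exact not_not.1 fun hi' => h (a := .inr i) hi' hi

theorem exists_isAntichain_mk_eq_two_power (I : Type u) [Infinite I] :
    ∃ A : Set (Set I), IsAntichain (· ⊆ ·) A ∧ #A = (2 : Cardinal.{u}) ^ #I := by
  obtain ⟨e⟩ : Nonempty (I ⊕ I ≃ I) := Cardinal.eq.1 (by simp)
  have hf : ∀ B C, e '' disjSumCompl B ⊆ e '' disjSumCompl C → B = C := fun B C h =>
    disjSumCompl_subset_disjSumCompl_iff.1 ((Set.image_subset_image_iff e.injective).1 h)
  refine ⟨Set.range fun B => e '' disjSumCompl B, ?_, ?_⟩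
  · rintro _ ⟨B, rfl⟩ _ ⟨C, rfl⟩ hne hle
    exact hne (hf B C hle ▸ rfl)
  · rw [mk_range_eq _ fun B C h => hf B C h.subset, mk_set]

end Antichain

theorem isClosed_strongTopology_scott_of_isUpperSet {X : Type*} [Preorder X] {S : Set X}
    (hS : IsUpperSet S) : IsClosed[strongTopology (Topology.scott X Set.univ)] S := by
  have hcompl : Sᶜ = ⋃ a ∈ Sᶜ, Set.Iic a := by
    ext b
    simp only [Set.mem_iUnion, Set.mem_Iic, exists_prop]
    exact ⟨fun hb => ⟨b, hb, le_rfl⟩, fun ⟨a, ha, hba⟩ hb => ha (hS hba hb)⟩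
  have hIic (a : X) : @IsLocallyClosed X (Topology.scott X Set.univ) (Set.Iic a) := by
    let := Topology.scott X Set.univ
    have : Topology.IsScott X Set.univ := ⟨rfl⟩
    exact isClosed_Iic.isLocallyClosed
  let := strongTopology (Topology.scott X Set.univ)
  rw [← isOpen_compl_iff, hcompl]
  exact isOpen_biUnion fun a _ => TopologicalSpace.isOpen_generateFrom_of_mem (hIic a)

section LowerSets

theorem mk_pfilter_le_mk_lowerSet (P : Type*) [Preorder P] :
    #(Order.PFilter P) ≤ #(LowerSet P) :=
  mk_le_of_injective (f := fun x : Order.PFilter P =>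
      ⟨(x : Set P)ᶜ, fun _ _ hqp hp hq => hp (Order.PFilter.mem_of_le hqp hq)⟩)
    fun _ _ h => SetLike.coe_injective (compl_injective (congrArg LowerSet.carrier h))

theorem mk_lowerSet_le (P : Type u) [Preorder P] :
    #(LowerSet P) ≤ (2 : Cardinal.{u}) ^ #P :=
  mk_set (α := P) ▸ mk_le_of_injective SetLike.coe_injective

theorem mk_lowerSet_finSubsetsRev (I : Type u) [Infinite I] :
    #(LowerSet (FinSubsetsRev I)) = (2 : Cardinal.{u}) ^ #(FinSubsetsRev I) :=
  (mk_lowerSet_le _).antisymm <| (mk_pfilter_finSubsetsRev I).ge.trans (mk_pfilter_le_mk_lowerSet _)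

end LowerSets

section FilterTopology

variable {P : Type u} [Preorder P]

/-- The Grothendieck topology induced by a set `S` of filters: a sieve is covering when it meets
every filter of `S` which contains its target. -/
def filterTopology (S : Set (Order.PFilter P)) : GrothendieckTopology P where
  sieves p := {R | ∀ x ∈ S, p ∈ x → ∃ (q : P) (f : q ⟶ p), R f ∧ q ∈ x}
  top_mem' p x _ hp := ⟨p, 𝟙 p, trivial, hp⟩
  pullback_stable' p q R f hR x hx hq := by
    obtain ⟨r, g, hg, hr⟩ := hR x hx (Order.PFilter.mem_of_le (leOfHom f) hq)
    obtain ⟨s, hs, hsq, hsr⟩ := x.directed q hq r hr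
    exact ⟨s, homOfLE hsq, R.downward_closed hg (homOfLE hsr), hs⟩
  transitive' p R hR T hT x hx hp := by
    obtain ⟨q, f, hf, hq⟩ := hR x hx hp
    obtain ⟨r, g, hg, hr⟩ := hT hf x hx hq
    exact ⟨r, g ≫ f, hg, hr⟩

/-- The indicator functor of a filter, which is the fibre functor of the corresponding point of
a presheaf topos. -/
def pfilterIndicator (x : Order.PFilter P) : P ⥤ Type u where
  obj p := ULift (PLift (p ∈ x))
  map f := ↾fun h => ⟨⟨Order.PFilter.mem_of_le (leOfHom f) h.down.down⟩⟩

instance (x : Order.PFilter P) : IsCofiltered (pfilterIndicator x).Elements where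
  nonempty :=
    let ⟨p, hp⟩ := x.nonempty
    ⟨⟨p, ⟨⟨hp⟩⟩⟩⟩
  cone_objs := by
    rintro ⟨p, ⟨⟨hp⟩⟩⟩ ⟨q, ⟨⟨hq⟩⟩⟩
    obtain ⟨r, hr, hrp, hrq⟩ := x.directed p hp q hq
    exact ⟨⟨r, ⟨⟨hr⟩⟩⟩, ⟨homOfLE hrp, rfl⟩, ⟨homOfLE hrq, rfl⟩, trivial⟩
  cone_maps a _ _ _ := ⟨a, 𝟙 a, congrArg _ (Subtype.ext (Subsingleton.elim _ _))⟩

/-- The point of `Sh(P, filterTopology S)` given by a filter in `S`. -/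
def filterTopologyPoint {S : Set (Order.PFilter P)} (x : S) :
    GrothendieckTopology.Point.{u} (filterTopology S) where
  fiber := pfilterIndicator x.1
  initiallySmall := initiallySmall_of_essentiallySmall _
  jointly_surjective := by
    rintro p R hR ⟨⟨hp⟩⟩
    obtain ⟨q, f, hf, hq⟩ := hR x.1 x.2 hp
    exact ⟨q, f, hf, ⟨⟨hq⟩⟩, rfl⟩

theorem hasEnoughPoints_filterTopology (S : Set (Order.PFilter P)) :
    GrothendieckTopology.HasEnoughPoints.{u} (filterTopology S) where
  exists_objectProperty := by
    refine ⟨.ofObj fun x : S => filterTopologyPoint x, inferInstance, ?_⟩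
    refine .mk' fun p R h x hx hp => ?_
    obtain ⟨q, f, hf, ⟨⟨hq⟩⟩, _⟩ :=
      h ⟨filterTopologyPoint ⟨x, hx⟩, ObjectProperty.ofObj_apply _ _⟩ ⟨⟨hp⟩⟩
    exact ⟨q, f, hf, hq⟩

/-- The sieve of the elements below `p` which are outside the filter `x`; it tells whether `x`
belongs to a set of pairwise incomparable filters from the topology which this set induces. -/
def pfilterComplSieve (x : Order.PFilter P) (p : P) : Sieve p where
  arrows q _ := q ∉ x
  downward_closed hq f hr := hq (Order.PFilter.mem_of_le (leOfHom f) hr)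

variable {A : Set (Order.PFilter P)}

theorem pfilterComplSieve_mem_filterTopology_iff (hA : IsAntichain (· ≤ ·) A)
    {S : Set (Order.PFilter P)} (hS : S ⊆ A) {x : Order.PFilter P} (hx : x ∈ A) {p : P}
    (hp : p ∈ x) : pfilterComplSieve x p ∈ filterTopology S p ↔ x ∉ S := by
  refine ⟨fun h hxS => ?_, fun h y hy hpy => ?_⟩
  · obtain ⟨q, f, hf, hq⟩ := h x hxS hp
    exact hf hq
  · have hyx : y ≠ x := fun e => h (e ▸ hy)
    obtain ⟨q, hqy, hqx⟩ := Set.not_subset.1 (hA (hS hy) hx hyx)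
    obtain ⟨r, hr, hrp, hrq⟩ := y.directed p hpy q hqy
    exact ⟨r, homOfLE hrp, fun hrx => hqx (Order.PFilter.mem_of_le hrq hrx), hr⟩

theorem injOn_filterTopology_powerset (hA : IsAntichain (· ≤ ·) A) :
    Set.InjOn filterTopology (𝒫 A) := by
  intro S hS T hT h
  ext x
  by_cases hx : x ∈ A
  · obtain ⟨p, hp⟩ := x.nonempty
    rw [← not_iff_not, ← pfilterComplSieve_mem_filterTopology_iff hA hS hx hp,
      ← pfilterComplSieve_mem_filterTopology_iff hA hT hx hp, h]
  · exact iff_of_false (fun h => hx (hS h)) (fun h => hx (hT h))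

theorem two_power_mk_le_mk_hasEnoughPoints (hA : IsAntichain (· ≤ ·) A) :
    (2 : Cardinal.{u}) ^ #A ≤
      #{J : GrothendieckTopology P // GrothendieckTopology.HasEnoughPoints.{u} J} := by
  rw [← mk_powerset]
  exact mk_le_of_injective (f := fun S : 𝒫 A =>
      ⟨filterTopology S.1, hasEnoughPoints_filterTopology S.1⟩)
    fun S T h => Subtype.ext (injOn_filterTopology_powerset hA S.2 T.2 (congrArg Subtype.val h))

end FilterTopology

section CountingTopologies

theorem mk_grothendieckTopology_le_two_power_mk_sieve (C : Type u) [SmallCategory C] :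
    #(GrothendieckTopology C) ≤ (2 : Cardinal.{u}) ^ #(Σ X : C, Sieve X) := by
  rw [← mk_set]
  refine mk_le_of_injective (f := fun J => {R : Σ X : C, Sieve X | R.2 ∈ J R.1}) fun J K h => ?_
  ext X R
  exact Set.ext_iff.1 h ⟨X, R⟩

theorem mk_sieve_le {P : Type u} [Preorder P] (p : P) : #(Sieve p) ≤ (2 : Cardinal.{u}) ^ #P := by
  rw [← mk_set]
  refine mk_le_of_injective (f := fun R : Sieve p => {q | ∃ f : q ⟶ p, R f}) fun R T h => ?_
  have hle {R T : Sieve p} (h : {q | ∃ f : q ⟶ p, R f} ⊆ {q | ∃ f : q ⟶ p, T f}) : R ≤ T := by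
    intro q f hf
    obtain ⟨g, hg⟩ := h ⟨f, hf⟩
    exact Subsingleton.elim g f ▸ hg
  exact (hle h.subset).antisymm (hle h.superset)

theorem mk_grothendieckTopology_le (P : Type u) [Preorder P] [Infinite P] :
    #(GrothendieckTopology P) ≤ (2 : Cardinal.{u}) ^ (2 : Cardinal.{u}) ^ #P := by
  refine (mk_grothendieckTopology_le_two_power_mk_sieve P).trans
    (power_le_power_left two_ne_zero ?_)
  calc #(Σ p : P, Sieve p) = Cardinal.sum fun p : P => #(Sieve p) := mk_sigma _
    _ ≤ Cardinal.sum fun _ : P => (2 : Cardinal.{u}) ^ #P := sum_le_sum _ _ mk_sieve_le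
    _ = #P * 2 ^ #P := sum_const' _ _
    _ ≤ 2 ^ #P * 2 ^ #P := mul_le_mul_left (cantor _).le _
    _ = 2 ^ #P := mul_eq_self ((aleph0_le_mk P).trans (cantor _).le)

variable (I : Type u) [Infinite I]

theorem two_power_two_power_le_mk_hasEnoughPoints_finSubsetsRev :
    (2 : Cardinal.{u}) ^ (2 : Cardinal.{u}) ^ #(FinSubsetsRev I) ≤
      #{J : GrothendieckTopology (FinSubsetsRev I) //
        GrothendieckTopology.HasEnoughPoints.{u} J} := by
  obtain ⟨A, hA, hcard⟩ := exists_isAntichain_mk_eq_two_power I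
  let e := (pfilterFinSubsetsRevIso I).symm
  calc (2 : Cardinal.{u}) ^ (2 : Cardinal.{u}) ^ #(FinSubsetsRev I) = 2 ^ #(e '' A) := by
        rw [mk_finSubsetsRev, mk_image_eq e.injective, hcard]
    _ ≤ _ := two_power_mk_le_mk_hasEnoughPoints (hA.image_relEmbedding e.toOrderEmbedding)

theorem mk_hasEnoughPoints_finSubsetsRev :
    #{J : GrothendieckTopology (FinSubsetsRev I) // GrothendieckTopology.HasEnoughPoints.{u} J}
      = (2 : Cardinal.{u}) ^ (2 : Cardinal.{u}) ^ #(FinSubsetsRev I) :=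
  ((mk_subtype_le _).trans (mk_grothendieckTopology_le _)).antisymm
    (two_power_two_power_le_mk_hasEnoughPoints_finSubsetsRev I)

theorem mk_grothendieckTopology_finSubsetsRev :
    #(GrothendieckTopology (FinSubsetsRev I))
      = (2 : Cardinal.{u}) ^ (2 : Cardinal.{u}) ^ #(FinSubsetsRev I) :=
  (mk_grothendieckTopology_le _).antisymm
    ((mk_hasEnoughPoints_finSubsetsRev I).ge.trans (mk_subtype_le _))

end CountingTopologies

section ClosedSubtopos

open Opposite

theorem bijective_snd_iff {α β : Type*} :
    Function.Bijective (Prod.snd : α × β → β) ↔ (Nonempty β → Nonempty (Unique α)) := by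
  refine ⟨fun h ⟨b⟩ => ?_, fun h => ⟨fun x y hxy => ?_, fun b => ?_⟩⟩
  · obtain ⟨⟨a, -⟩, -⟩ := h.2 b
    exact ⟨⟨⟨a⟩, fun a' => congrArg Prod.fst (@h.1 (a', b) (a, b) rfl)⟩⟩
  · obtain ⟨_⟩ := h ⟨x.2⟩
    exact Prod.ext (Subsingleton.elim _ _) hxy
  · obtain ⟨_⟩ := h ⟨b⟩
    exact ⟨(default, b), rfl⟩

theorem isIso_prod_snd_iff {C : Type u} [Category.{v} C] (F U : C ⥤ Type w) :
    IsIso (prod.snd : F ⨯ U ⟶ U) ↔ ∀ c, Nonempty (U.obj c) → Nonempty (Unique (F.obj c)) := by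
  rw [← FunctorToTypes.binaryProductIso_hom_comp_snd, isIso_comp_left_iff,
    NatTrans.isIso_iff_isIso_app]
  exact forall_congr' fun c => (isIso_iff_bijective _).trans bijective_snd_iff

variable {P : Type u} [Preorder P]

/-- The Grothendieck topology of the closed complement of the lower set `U`: a sieve on `p` is
covering when it is maximal or `p` belongs to `U`. -/
def closedTopology (U : LowerSet P) : GrothendieckTopology P where
  sieves p := {R | R = ⊤ ∨ p ∈ U}
  top_mem' _ := Or.inl rfl
  pullback_stable' p q R f hR := by
    rcases hR with rfl | hp
    · exact Or.inl rfl
    · exact Or.inr (U.lower (leOfHom f) hp)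
  transitive' p R hR T hT := by
    rcases hR with rfl | hp
    · simpa using hT (f := 𝟙 p) trivial
    · exact Or.inr hp

theorem bot_mem_closedTopology_iff {U : LowerSet P} {p : P} :
    (⊥ : Sieve p) ∈ closedTopology U p ↔ p ∈ U :=
  or_iff_right fun h : (⊥ : Sieve p) = ⊤ => (h ▸ trivial : (⊥ : Sieve p) (𝟙 p))

theorem closedTopology_injective :
    Function.Injective (closedTopology : LowerSet P → GrothendieckTopology P) := fun U V h =>
  SetLike.ext fun p => by rw [← bot_mem_closedTopology_iff, h, bot_mem_closedTopology_iff]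

theorem isSheaf_closedTopology_iff (U : LowerSet P) (F : Pᵒᵖ ⥤ Type u) :
    Presheaf.IsSheaf (closedTopology U) F ↔
      ∀ c, c.unop ∈ U → Nonempty (Unique (F.obj c)) := by
  rw [isSheaf_iff_isSheaf_of_type]
  constructor
  · rintro h ⟨p⟩ hp
    obtain ⟨a, -, ha⟩ := h (⊥ : Sieve p) (Or.inr hp) (fun _ _ h => h.elim)
      (fun _ _ _ _ _ _ _ h => h.elim)
    exact ⟨⟨⟨a⟩, fun b => ha b fun _ _ h => h.elim⟩⟩
  · rintro h p R (rfl | hp)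
    · exact Presieve.isSheafFor_top F
    · intro x _
      have hunique (q : P) (hq : q ≤ p) : Nonempty (Unique (F.obj (op q))) :=
        h (op q) (U.lower hq hp)
      obtain ⟨_⟩ := hunique p le_rfl
      refine ⟨default, fun q f _ => ?_, fun _ _ => Subsingleton.elim _ _⟩
      obtain ⟨_⟩ := hunique q (leOfHom f)
      exact Subsingleton.elim _ _

/-- The lower set of the elements at which a presheaf is inhabited. -/
def presheafSupport (U : Pᵒᵖ ⥤ Type u) : LowerSet P where
  carrier := {p | Nonempty (U.obj (op p))}
  lower' _ _ hqp := Nonempty.map (U.map (homOfLE hqp).op)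

/-- The subterminal presheaf supported on a lower set. -/
def lowerSetIndicator (U : LowerSet P) : Pᵒᵖ ⥤ Type u where
  obj c := ULift (PLift (c.unop ∈ U))
  map f := ↾fun h => ⟨⟨U.lower (leOfHom f.unop) h.down.down⟩⟩

instance (U : LowerSet P) (c : Pᵒᵖ) : Subsingleton ((lowerSetIndicator U).obj c) :=
  inferInstanceAs (Subsingleton (ULift (PLift (c.unop ∈ U))))

theorem isClosedSubtopos_iff (J : GrothendieckTopology P) :
    IsClosedSubtopos J ↔ ∃ U : LowerSet P, closedTopology U = J := by
  constructor
  · rintro ⟨U, -, hU⟩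
    refine ⟨presheafSupport U, topology_eq_iff_same_sheaves.2 fun F => ?_⟩
    rw [← isSheaf_iff_isSheaf_of_type, ← isSheaf_iff_isSheaf_of_type, hU,
      isIso_prod_snd_iff, isSheaf_closedTopology_iff]
    rfl
  · rintro ⟨U, rfl⟩
    refine ⟨lowerSetIndicator U, ⟨fun _ _ _ => ?_⟩, fun F => ?_⟩
    · ext
      exact Subsingleton.elim _ _
    · rw [isIso_prod_snd_iff, isSheaf_closedTopology_iff]
      exact forall_congr' fun c => ⟨fun h ⟨⟨⟨hc⟩⟩⟩ => h hc, fun h hc => h ⟨⟨⟨hc⟩⟩⟩⟩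

theorem mk_isClosedSubtopos (P : Type u) [Preorder P] :
    #{J : GrothendieckTopology P // IsClosedSubtopos J} = #(LowerSet P) := by
  simp_rw [isClosedSubtopos_iff]
  exact mk_range_eq _ closedTopology_injective

end ClosedSubtopos

section Sheafify

variable {C : Type u} [Category.{v} C] {J : GrothendieckTopology C} {X Y : Cᵒᵖ ⥤ Type w}

theorem sieveOfSection_map (G : Subfunctor X) {c d : Cᵒᵖ} (f : c ⟶ d) (a : X.obj c) :
    G.sieveOfSection (X.map f a) = (G.sieveOfSection a).pullback f.unop := by
  ext e g
  simp [Sieve.pullback_apply]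

theorem sheafify_le_sheafify_of_le_sheafify {G H : Subfunctor X} (h : G ≤ H.sheafify J) :
    G.sheafify J ≤ H.sheafify J := by
  intro c a ha
  refine J.transitive ha _ fun d f hf => ?_
  rw [← Quiver.Hom.unop_op f, ← sieveOfSection_map]
  exact h _ hf

theorem sheafify_mono {G H : Subfunctor X} (h : G ≤ H) : G.sheafify J ≤ H.sheafify J :=
  sheafify_le_sheafify_of_le_sheafify (h.trans (H.le_sheafify J))

theorem sheafify_inf (G H : Subfunctor X) :
    (G ⊓ H).sheafify J = G.sheafify J ⊓ H.sheafify J :=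
  le_antisymm (le_inf (sheafify_mono inf_le_left) (sheafify_mono inf_le_right))
    fun _ _ ha => J.intersection_covering ha.1 ha.2

theorem sheafify_preimage (f : X ⟶ Y) (G : Subfunctor Y) :
    (G.preimage f).sheafify J = (G.sheafify J).preimage f := by
  have hsieve {c : Cᵒᵖ} (a : X.obj c) :
      (G.preimage f).sieveOfSection a = G.sieveOfSection (f.app c a) := by
    ext d k
    simp
  ext c a
  change _ ∈ J _ ↔ _ ∈ J _
  rw [hsieve]

theorem image_sheafify_le (f : X ⟶ Y) (G : Subfunctor X) :
    (G.sheafify J).image f ≤ (G.image f).sheafify J := by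
  rw [Subfunctor.image_le_iff, ← sheafify_preimage]
  exact sheafify_mono ((Subfunctor.image_le_iff _ _ _).1 le_rfl)

theorem sheafify_bot (G : Subfunctor X) : G.sheafify ⊥ = G := by
  refine le_antisymm (fun c a ha => ?_) (G.le_sheafify ⊥)
  have htop : G.sieveOfSection a = ⊤ := GrothendieckTopology.bot_covering.1 ha
  simpa using (htop ▸ trivial : G.sieveOfSection a (𝟙 c.unop))

end Sheafify

section FinitelyGenerated

variable {C : Type u} [Category.{v} C] {X : Cᵒᵖ ⥤ Type w}

open Subfunctor

instance isFinite_ofSection {c : Cᵒᵖ} (a : X.obj c) : (ofSection a).IsFinite :=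
  IsGeneratedBy.isFinite _ (x := fun _ : Unit => a) iSup_const

instance isFinite_iSup {ι : Type*} [Finite ι] (G : ι → Subfunctor X) [∀ i, (G i).IsFinite] :
    (⨆ i, G i).IsFinite := by
  refine IsGeneratedBy.isFinite _ (x := fun t : Σ i, IsFinite.Index (G i) => IsFinite.x t.2) ?_
  exact iSup_sigma.trans (iSup_congr fun i => (isGeneratedBy_of_isFinite (G i)).iSup_eq)

theorem exists_finset_le_iSup_of_isFinite {G : Subfunctor X} [G.IsFinite] {ι : Type*}
    {H : ι → Subfunctor X} (h : G ≤ ⨆ i, H i) : ∃ s : Finset ι, G ≤ ⨆ i : s, H i := by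
  have hgen := isGeneratedBy_of_isFinite G
  have hmem (j : IsFinite.Index G) : ∃ i, IsFinite.x j ∈ (H i).obj (IsFinite.X j) := by
    simpa using h _ (hgen.mem j)
  choose i hi using hmem
  have hfin := Set.finite_range i
  refine ⟨hfin.toFinset, hgen.iSup_eq.ge.trans (iSup_le fun j => ?_)⟩
  refine ((ofSection_le_iff _ _).2 (hi j)).trans ?_
  exact le_iSup (fun i : hfin.toFinset => H i) ⟨i j, hfin.mem_toFinset.2 ⟨j, rfl⟩⟩

end FinitelyGenerated

section LocallyFinitelyGenerated

variable {C : Type u} [Category.{v} C] (J : GrothendieckTopology C) {X Y : Cᵒᵖ ⥤ Type w}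

variable (X) in
/-- A presheaf is locally finitely generated for `J` if finitely many of its sections generate it
locally. For sheaves, this will turn out to be compactness. -/
def IsLocallyFinitelyGenerated : Prop :=
  ∃ G : Subfunctor X, G.IsFinite ∧ G.sheafify J = ⊤

variable {J}

theorem isLocallyFinitelyGenerated_of_presheafIsFinite [h : PresheafIsFinite X] :
    IsLocallyFinitelyGenerated J X :=
  ⟨⊤, h, top_le_iff.1 (Subfunctor.le_sheafify J _)⟩

theorem isLocallyFinitelyGenerated_bot_iff :
    IsLocallyFinitelyGenerated ⊥ X ↔ PresheafIsFinite X := by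
  refine ⟨?_, fun h => isLocallyFinitelyGenerated_of_presheafIsFinite⟩
  rintro ⟨G, hG, hGtop⟩
  rwa [PresheafIsFinite, ← hGtop, sheafify_bot]

theorem IsLocallyFinitelyGenerated.of_sheafify_range_eq_top (hX : IsLocallyFinitelyGenerated J X)
    {f : X ⟶ Y} (hf : (Subfunctor.range f).sheafify J = ⊤) : IsLocallyFinitelyGenerated J Y := by
  obtain ⟨G, hG, hGtop⟩ := hX
  refine ⟨G.image f, G.image_isFinite f, top_le_iff.1 ?_⟩
  rw [← hf]
  refine sheafify_le_sheafify_of_le_sheafify ?_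
  rw [← Subfunctor.image_top, ← hGtop]
  exact image_sheafify_le f G

end LocallyFinitelyGenerated

section SheafModel

variable {C : Type u} [SmallCategory C] {J : GrothendieckTopology C} {X : Cᵒᵖ ⥤ Type u}

open Opposite

theorem iSup_range_ι_comp_eq_iff {ι : Type*} {Y : ι → Cᵒᵖ ⥤ Type u} {f : ∀ i, Y i ⟶ X}
    {Z : Cᵒᵖ ⥤ Type u} {g h : X ⟶ Z} :
    (⨆ i, Subfunctor.range (f i)).ι ≫ g = (⨆ i, Subfunctor.range (f i)).ι ≫ h ↔
      ∀ i, f i ≫ g = f i ≫ h := by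
  constructor
  · intro hgh i
    rw [← Subfunctor.lift_ι (f i) (le_iSup (fun i => Subfunctor.range (f i)) i), Category.assoc,
      hgh, Category.assoc]
  · intro hgh
    ext c ⟨a, ha⟩
    obtain ⟨i, y, rfl⟩ : ∃ i, a ∈ (Subfunctor.range (f i)).obj c := by simpa using ha
    exact ConcreteCategory.congr_hom (NatTrans.congr_app (hgh i) c) y

theorem sheafify_eq_top_iff_epi_presheafToSheaf_map (G : Subfunctor X) :
    G.sheafify J = ⊤ ↔ Epi ((presheafToSheaf J (Type u)).map G.ι) := by
  rw [← Sheaf.isLocallySurjective_iff_epi, Presheaf.isLocallySurjective_presheafToSheaf_map_iff,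
    Presheaf.isLocallySurjective_iff_range_sheafify_eq_top', Subfunctor.range_ι]

theorem sheafify_eq_top_iff_forall_isSheaf (G : Subfunctor X) :
    G.sheafify J = ⊤ ↔ ∀ ⦃Z : Cᵒᵖ ⥤ Type u⦄, Presheaf.IsSheaf J Z →
      ∀ g h : X ⟶ Z, G.ι ≫ g = G.ι ≫ h → g = h := by
  let adj := sheafificationAdjunction J (Type u)
  rw [sheafify_eq_top_iff_epi_presheafToSheaf_map]
  constructor
  · intro hepi Z hZ g h hgh
    refine (adj.homEquiv X ⟨Z, hZ⟩).symm.injective ?_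
    rw [← cancel_epi ((presheafToSheaf J (Type u)).map G.ι)]
    exact (adj.homEquiv_naturality_left_symm _ _).symm.trans
      ((congrArg _ hgh).trans (adj.homEquiv_naturality_left_symm _ _))
  · refine fun H => ⟨fun g h hgh => (adj.homEquiv _ _).injective
      (H (ObjectProperty.FullSubcategory.property _) _ _ ?_)⟩
    rw [← adj.homEquiv_naturality_left, hgh, adj.homEquiv_naturality_left]

theorem essImage_sheafToPresheaf_iff (Z : Cᵒᵖ ⥤ Type u) :
    (sheafToPresheaf J (Type u)).essImage Z ↔ Presheaf.IsSheaf J Z :=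
  ⟨fun ⟨F, ⟨e⟩⟩ => (Presheaf.isSheaf_of_iso_iff e).1 F.property,
    fun hZ => ⟨⟨Z, hZ⟩, ⟨Iso.refl _⟩⟩⟩

theorem essImage_id_iff_isSheaf_bot (Z : Cᵒᵖ ⥤ Type u) :
    (𝟭 (Cᵒᵖ ⥤ Type u)).essImage Z ↔ Presheaf.IsSheaf ⊥ Z :=
  iff_of_true ⟨Z, ⟨Iso.refl _⟩⟩ (Presheaf.isSheaf_bot Z)

-- `E` stands for `Sheaf J (Type u)` or, when `J = ⊥`, for the presheaf category itself.
variable {E : Type w} [Category.{u} E] {U : E ⥤ Cᵒᵖ ⥤ Type u}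
  (hU : ∀ Z, U.essImage Z ↔ Presheaf.IsSheaf J Z)

include hU

theorem sheafify_iSup_range_eq_top_iff {ι : Type*} {Y : ι → Cᵒᵖ ⥤ Type u} (f : ∀ i, Y i ⟶ X) :
    (⨆ i, Subfunctor.range (f i)).sheafify J = ⊤ ↔
      ∀ (Z : E) (g h : X ⟶ U.obj Z), (∀ i, f i ≫ g = f i ≫ h) → g = h := by
  simp only [sheafify_eq_top_iff_forall_isSheaf, iSup_range_ι_comp_eq_iff]
  refine ⟨fun H Z => H ((hU _).1 (U.obj_mem_essImage Z)), fun H Z hZ g h hgh => ?_⟩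
  obtain ⟨Z', ⟨e⟩⟩ := (hU Z).2 hZ
  rw [← cancel_mono e.inv]
  exact H _ _ _ fun i => by rw [reassoc_of% hgh i]

variable {L : (Cᵒᵖ ⥤ Type u) ⥤ E} (adj : L ⊣ U)

include adj in
theorem epimorphicFamily_map_iff {ι : Type*} {Y : ι → Cᵒᵖ ⥤ Type u} (f : ∀ i, Y i ⟶ X) :
    EpimorphicFamily (fun i => L.map (f i)) ↔
      (⨆ i, Subfunctor.range (f i)).sheafify J = ⊤ := by
  rw [sheafify_iSup_range_eq_top_iff hU]
  refine forall_congr' fun Z => ?_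
  simp only [(adj.homEquiv X Z).symm.surjective.forall, ← adj.homEquiv_naturality_left_symm,
    Equiv.apply_eq_iff_eq]

variable [U.Full] [U.Faithful]

theorem epimorphicFamily_iff {X : E} {ι : Type*} {Y : ι → E} (f : ∀ i, Y i ⟶ X) :
    EpimorphicFamily f ↔ (⨆ i, Subfunctor.range (U.map (f i))).sheafify J = ⊤ := by
  rw [sheafify_iSup_range_eq_top_iff hU]
  refine forall_congr' fun Z => ?_
  simp only [U.map_surjective.forall, ← U.map_comp, U.map_injective.eq_iff]

theorem epimorphicFamily_homEquiv_symm_iff {X : E} {ι : Type*} {Y : ι → Cᵒᵖ ⥤ Type u}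
    (f : ∀ i, Y i ⟶ U.obj X) :
    EpimorphicFamily (fun i => (adj.homEquiv _ _).symm (f i)) ↔
      (⨆ i, Subfunctor.range (f i)).sheafify J = ⊤ := by
  rw [sheafify_iSup_range_eq_top_iff hU]
  refine forall_congr' fun Z => ?_
  simp only [U.map_surjective.forall, ← adj.homEquiv_naturality_right_symm, Equiv.apply_eq_iff_eq,
    U.map_injective.eq_iff]

theorem sheafify_range_unit_eq_top (X : Cᵒᵖ ⥤ Type u) :
    (Subfunctor.range (adj.unit.app X)).sheafify J = ⊤ := by
  rw [← iSup_const (ι := Unit) (a := Subfunctor.range (adj.unit.app X)),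
    ← epimorphicFamily_homEquiv_symm_iff hU adj fun _ : Unit => adj.unit.app X]
  intro Z g h hgh
  simpa [Adjunction.homEquiv_counit] using hgh ()

theorem epimorphicFamily_homEquiv_symm_sections (X : E) :
    EpimorphicFamily fun t : Σ c : C, (U.obj X).obj (op c) =>
      (adj.homEquiv _ _).symm (yonedaEquiv.symm t.2) := by
  rw [epimorphicFamily_homEquiv_symm_iff hU]
  refine top_le_iff.1 (le_trans ?_ (Subfunctor.le_sheafify J _))
  intro c a _
  simp only [Subfunctor.iSup_obj, Set.mem_iUnion]
  refine ⟨⟨c.unop, a⟩, ?_⟩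
  rw [← Subfunctor.ofSection_eq_range (X := c)]
  exact Subfunctor.mem_ofSection_obj a

end SheafModel

section FiniteType

variable {C : Type u} [SmallCategory C]

/-- The sieve generated by a finite set of morphisms with codomain `X`. -/
def sieveOfFinset {X : C} (s : Finset (Σ Y, Y ⟶ X)) : Sieve X :=
  Sieve.ofArrows (fun f : s => f.1.1) fun f => f.1.2

theorem sieveOfFinset_le_iff {X : C} {s : Finset (Σ Y, Y ⟶ X)} {R : Sieve X} :
    sieveOfFinset s ≤ R ↔ ∀ f ∈ s, R f.2 := by
  rw [sieveOfFinset, Sieve.ofArrows, Sieve.generate_le_iff]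
  refine ⟨fun h f hf => h _ _ (Presieve.ofArrows.mk (⟨f, hf⟩ : s)), ?_⟩
  rintro h Y _ ⟨f⟩
  exact h _ f.2

theorem sieveOfFinset_singleton_id (X : C) :
    sieveOfFinset ({⟨X, 𝟙 X⟩} : Finset (Σ Y, Y ⟶ X)) = ⊤ :=
  Sieve.id_mem_iff_eq_top.1 (sieveOfFinset_le_iff.1 le_rfl ⟨X, 𝟙 X⟩ (Finset.mem_singleton_self _))

/-- A Grothendieck topology is of finite type if every covering sieve contains a finitely generated
covering sieve. -/
def IsFiniteTypeTopology (J : GrothendieckTopology C) : Prop :=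
  ∀ ⦃X : C⦄ (R : Sieve X), R ∈ J X →
    ∃ s : Finset (Σ Y, Y ⟶ X), sieveOfFinset s ≤ R ∧ sieveOfFinset s ∈ J X

theorem isFiniteTypeTopology_bot : IsFiniteTypeTopology (⊥ : GrothendieckTopology C) := by
  intro X R hR
  obtain rfl := GrothendieckTopology.bot_covering.1 hR
  exact ⟨{⟨X, 𝟙 X⟩}, le_top, sieveOfFinset_singleton_id X ▸ GrothendieckTopology.top_mem _ _⟩

theorem isFiniteTypeTopology_closedTopology {P : Type u} [Preorder P] (U : LowerSet P) :
    IsFiniteTypeTopology (closedTopology U) := by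
  rintro p R (rfl | hp)
  · exact ⟨{⟨p, 𝟙 p⟩}, le_top, .inl (sieveOfFinset_singleton_id p)⟩
  · exact ⟨∅, sieveOfFinset_le_iff.2 (by simp), .inr hp⟩

theorem IsFiniteTypeTopology.mem_iff {J : GrothendieckTopology C} (hJ : IsFiniteTypeTopology J)
    {X : C} {R : Sieve X} :
    R ∈ J X ↔ ∃ s : Finset (Σ Y, Y ⟶ X), sieveOfFinset s ≤ R ∧ sieveOfFinset s ∈ J X :=
  ⟨hJ R, fun ⟨_, hle, hs⟩ => J.superset_covering hle hs⟩

theorem mk_isFiniteTypeTopology_le_two_power (C : Type u) [SmallCategory C] :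
    #{J : GrothendieckTopology C // IsFiniteTypeTopology J} ≤
      (2 : Cardinal.{u}) ^ #(Σ X : C, Finset (Σ Y, Y ⟶ X)) := by
  rw [← mk_set]
  refine mk_le_of_injective (f := fun J => {t | sieveOfFinset t.2 ∈ J.1 t.1}) fun J K h => ?_
  ext X R
  rw [J.2.mem_iff, K.2.mem_iff]
  exact exists_congr fun s => and_congr_right fun _ => Set.ext_iff.1 h ⟨X, s⟩

theorem mk_isFiniteTypeTopology_le (P : Type u) [Preorder P] [Infinite P] :
    #{J : GrothendieckTopology P // IsFiniteTypeTopology J} ≤ (2 : Cardinal.{u}) ^ #P := by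
  have hfst (p : P) : Function.Injective (Sigma.fst : (Σ q, q ⟶ p) → P) := by
    rintro ⟨q, f⟩ ⟨_, g⟩ rfl
    rw [Subsingleton.elim f g]
  refine (mk_isFiniteTypeTopology_le_two_power P).trans (power_le_power_left two_ne_zero ?_)
  calc #(Σ p : P, Finset (Σ q, q ⟶ p)) = Cardinal.sum fun p : P => #(Finset (Σ q, q ⟶ p)) :=
        mk_sigma _
    _ ≤ Cardinal.sum fun _ : P => #(Finset P) :=
        sum_le_sum _ _ fun p => mk_le_of_injective (Finset.map_injective ⟨_, hfst p⟩)
    _ = #P := by rw [sum_const', mk_finset_of_infinite, mul_eq_self (aleph0_le_mk P)]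

variable {J : GrothendieckTopology C} {X : Cᵒᵖ ⥤ Type u}

theorem IsFiniteTypeTopology.exists_isFinite_le_of_mem_sheafify (hJ : IsFiniteTypeTopology J)
    {H : Subfunctor X} {c : Cᵒᵖ} {a : X.obj c} (ha : a ∈ (H.sheafify J).obj c) :
    ∃ K ≤ H, K.IsFinite ∧ a ∈ (K.sheafify J).obj c := by
  obtain ⟨s, hs, hsJ⟩ := hJ _ ha
  let K := ⨆ f : s, Subfunctor.ofSection (X.map f.1.2.op a)
  refine ⟨K, iSup_le fun f => ?_, inferInstance, J.superset_covering ?_ hsJ⟩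
  · exact (Subfunctor.ofSection_le_iff _ _).2 (sieveOfFinset_le_iff.1 hs f f.2)
  · refine sieveOfFinset_le_iff.2 fun f hf => ?_
    exact le_iSup (fun f : s => Subfunctor.ofSection (X.map f.1.2.op a)) ⟨f, hf⟩ _
      (Subfunctor.mem_ofSection_obj _)

theorem IsFiniteTypeTopology.exists_isFinite_le (hJ : IsFiniteTypeTopology J)
    (hX : IsLocallyFinitelyGenerated J X) {H : Subfunctor X} (hH : H.sheafify J = ⊤) :
    ∃ K ≤ H, K.IsFinite ∧ K.sheafify J = ⊤ := by
  obtain ⟨G, hG, hGtop⟩ := hX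
  have hgen := Subfunctor.isGeneratedBy_of_isFinite G
  choose K hKH hK hmem using fun j : Subfunctor.IsFinite.Index G =>
    hJ.exists_isFinite_le_of_mem_sheafify (H := H) (a := Subfunctor.IsFinite.x j)
      (hH ▸ Set.mem_univ _)
  refine ⟨⨆ j, K j, iSup_le hKH, inferInstance, top_le_iff.1 ?_⟩
  rw [← hGtop]
  refine sheafify_le_sheafify_of_le_sheafify (hgen.iSup_eq.ge.trans (iSup_le fun j => ?_))
  exact (Subfunctor.ofSection_le_iff _ _).2 (sheafify_mono (le_iSup K j) _ (hmem j))

theorem IsFiniteTypeTopology.exists_finset_sheafify_iSup_eq_top (hJ : IsFiniteTypeTopology J)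
    (hX : IsLocallyFinitelyGenerated J X) {ι : Type*} {H : ι → Subfunctor X}
    (hH : (⨆ i, H i).sheafify J = ⊤) : ∃ s : Finset ι, (⨆ i : s, H i).sheafify J = ⊤ := by
  obtain ⟨K, hKH, hK, hKtop⟩ := hJ.exists_isFinite_le hX hH
  obtain ⟨s, hs⟩ := exists_finset_le_iSup_of_isFinite hKH
  exact ⟨s, top_le_iff.1 (hKtop ▸ sheafify_mono hs)⟩

end FiniteType

section Compact

variable {C : Type u} [SmallCategory C] {J : GrothendieckTopology C} {E : Type w} [Category.{u} E]
  {U : E ⥤ Cᵒᵖ ⥤ Type u} (hU : ∀ Z, U.essImage Z ↔ Presheaf.IsSheaf J Z) [U.Full] [U.Faithful]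
  {L : (Cᵒᵖ ⥤ Type u) ⥤ E} (adj : L ⊣ U)

include hU adj

theorem isLocallyFinitelyGenerated_of_isCompactObject {X : E} (hX : IsCompactObject X) :
    IsLocallyFinitelyGenerated J (U.obj X) := by
  obtain ⟨s, hs⟩ := hX _ _ (epimorphicFamily_homEquiv_symm_sections hU adj X)
  refine ⟨_, ?_, (epimorphicFamily_homEquiv_symm_iff hU adj _).1 hs⟩
  have hfin (t : s) : (Subfunctor.range (yonedaEquiv.symm t.1.2)).IsFinite :=
    Subfunctor.range_isFinite _ _
  exact isFinite_iSup _

theorem isCompactObject_iff (hJ : IsFiniteTypeTopology J) {X : E} :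
    IsCompactObject X ↔ IsLocallyFinitelyGenerated J (U.obj X) := by
  refine ⟨isLocallyFinitelyGenerated_of_isCompactObject hU adj, fun hX ι Y f hf => ?_⟩
  obtain ⟨s, hs⟩ := hJ.exists_finset_sheafify_iSup_eq_top hX ((epimorphicFamily_iff hU f).1 hf)
  exact ⟨s, (epimorphicFamily_iff hU _).2 hs⟩

theorem isCompactObject_map (hJ : IsFiniteTypeTopology J) {F : Cᵒᵖ ⥤ Type u}
    (hF : IsLocallyFinitelyGenerated J F) : IsCompactObject (L.obj F) :=
  (isCompactObject_iff hU adj hJ).2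
    (hF.of_sheafify_range_eq_top (sheafify_range_unit_eq_top hU adj F))

end Compact

theorem isCompactObject_presheaf_iff {C : Type u} [SmallCategory C] {F : Cᵒᵖ ⥤ Type u} :
    IsCompactObject F ↔ PresheafIsFinite F :=
  (isCompactObject_iff essImage_id_iff_isSheaf_bot Adjunction.id isFiniteTypeTopology_bot).trans
    isLocallyFinitelyGenerated_bot_iff

section PullbacksOfSections

open Opposite

variable {C : Type u} [SmallCategory C] {J : GrothendieckTopology C} {F X Y Z Q : Cᵒᵖ ⥤ Type u}

open Subfunctor in
theorem isLocallyFinitelyGenerated_of_forall_ofSection (a : Q ⟶ Y) (b : Q ⟶ Z) {G : Subfunctor Y}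
    {H : Subfunctor Z} [G.IsFinite] [H.IsFinite] (hG : G.sheafify J = ⊤) (hH : H.sheafify J = ⊤)
    (h : ∀ ⦃c d⦄, ∀ y ∈ G.obj c, ∀ z ∈ H.obj d, ∃ W : Subfunctor Q, W.IsFinite ∧
      (ofSection y).preimage a ⊓ (ofSection z).preimage b ≤ W.sheafify J) :
    IsLocallyFinitelyGenerated J Q := by
  have hGgen := isGeneratedBy_of_isFinite G
  have hHgen := isGeneratedBy_of_isFinite H
  choose W hW hle using fun i j => h _ (hGgen.mem i) _ (hHgen.mem j)
  refine ⟨⨆ i, ⨆ j, W i j, inferInstance, top_le_iff.1 ?_⟩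
  calc ⊤ = (G.preimage a ⊓ H.preimage b).sheafify J := by
        rw [sheafify_inf, sheafify_preimage, sheafify_preimage, hG, hH]
        exact (top_inf_eq (⊤ : Subfunctor Q)).symm
    _ ≤ (⨆ i, ⨆ j, W i j).sheafify J := sheafify_le_sheafify_of_le_sheafify fun c q hq => ?_
  obtain ⟨i, hi⟩ : ∃ i, q ∈ ((ofSection (IsFinite.x i)).preimage a).obj c := by
    simpa [← hGgen.iSup_eq] using hq.1
  obtain ⟨j, hj⟩ : ∃ j, q ∈ ((ofSection (IsFinite.x j)).preimage b).obj c := by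
    simpa [← hHgen.iSup_eq] using hq.2
  exact sheafify_mono (le_iSup₂ (f := W) i j) _ (hle i j _ ⟨hi, hj⟩)

/-- A presheaf `F` is quasi-separated if the fibre product over `F` of any two representables is
finitely generated. Finitely generated quasi-separated presheaves will turn out to be the coherent
ones. -/
def PresheafIsQuasiSeparated (F : Cᵒᵖ ⥤ Type u) : Prop :=
  ∀ ⦃c d : C⦄ (u : yoneda.obj c ⟶ F) (v : yoneda.obj d ⟶ F), PresheafIsFinite (pullback u v)

theorem preimage_range_inf_preimage_range_le {A B R : Cᵒᵖ ⥤ Type u} (η : F ⟶ X)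
    [Presheaf.IsLocallyInjective J η] {a : Q ⟶ Y} {b : Q ⟶ Z} {f : Y ⟶ X} {g : Z ⟶ X}
    (hQ : IsPullback a b f g) {p : R ⟶ A} {q : R ⟶ B} {u : A ⟶ F} {v : B ⟶ F}
    (hR : IsPullback p q u v) {y : A ⟶ Y} {z : B ⟶ Z} {w : R ⟶ Q} (hy : y ≫ f = u ≫ η)
    (hz : z ≫ g = v ≫ η) (ha : w ≫ a = p ≫ y) (hb : w ≫ b = q ≫ z) :
    (Subfunctor.range y).preimage a ⊓ (Subfunctor.range z).preimage b ≤
      (Subfunctor.range w).sheafify J := by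
  have happ {S T : Cᵒᵖ ⥤ Type u} {m n : S ⟶ T} (h : m = n) {c : Cᵒᵖ} (x : S.obj c) :
      m.app c x = n.app c x := by rw [h]
  rintro c x ⟨⟨s, hs⟩, ⟨t, ht⟩⟩
  -- Two sections of `F` with the same image under `η` agree locally, hence lift locally to `R`.
  have hη : η.app c (u.app c s) = η.app c (v.app c t) := calc
    _ = f.app c (y.app c s) := (happ hy s).symm
    _ = g.app c (z.app c t) := by rw [hs, ht]; exact happ hQ.w x
    _ = _ := happ hz t
  refine J.superset_covering (fun d k hk => ?_) (Presheaf.equalizerSieve_mem J η _ _ hη)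
  obtain ⟨r, hrs, hrt⟩ := Types.exists_of_isPullback (hR.map ((evaluation _ _).obj (op d)))
    (A.map k.op s) (B.map k.op t)
    ((NatTrans.naturality_apply u k.op s).trans
      (hk.trans (NatTrans.naturality_apply v k.op t).symm))
  refine ⟨r, Types.ext_of_isPullback (hQ.map ((evaluation _ _).obj (op d))) ?_ ?_⟩
  · calc a.app _ (w.app _ r) = y.app _ (p.app _ r) := happ ha r
      _ = a.app _ (Q.map k.op x) := by
        rw [NatTrans.naturality_apply, ← hs, ← NatTrans.naturality_apply]
        exact congrArg _ hrs
  · calc b.app _ (w.app _ r) = z.app _ (q.app _ r) := happ hb r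
      _ = b.app _ (Q.map k.op x) := by
        rw [NatTrans.naturality_apply, ← ht, ← NatTrans.naturality_apply]
        exact congrArg _ hrt

theorem exists_isFinite_preimage_ofSection_inf_le (hF : PresheafIsQuasiSeparated F) (η : F ⟶ X)
    [Presheaf.IsLocallyInjective J η] {a : Q ⟶ Y} {b : Q ⟶ Z} {f : Y ⟶ X} {g : Z ⟶ X}
    (hQ : IsPullback a b f g) {c d : C} {u : F.obj (op c)} {v : F.obj (op d)} {y : Y.obj (op c)}
    {z : Z.obj (op d)} (hy : η.app _ u = f.app _ y) (hz : η.app _ v = g.app _ z) :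
    ∃ W : Subfunctor Q, W.IsFinite ∧
      (Subfunctor.ofSection y).preimage a ⊓ (Subfunctor.ofSection z).preimage b ≤
        W.sheafify J := by
  have hfactor {V : Cᵒᵖ ⥤ Type u} {f : V ⟶ X} {c : C} {u : F.obj (op c)} {y : V.obj (op c)}
      (h : η.app _ u = f.app _ y) : yonedaEquiv.symm y ≫ f = yonedaEquiv.symm u ≫ η := by
    rw [yonedaEquiv_symm_naturality_right, yonedaEquiv_symm_naturality_right]
    exact congrArg _ h.symm
  have hR := IsPullback.of_hasPullback (yonedaEquiv.symm u) (yonedaEquiv.symm v)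
  have hfin := hF (yonedaEquiv.symm u) (yonedaEquiv.symm v)
  obtain ⟨w, ha, hb⟩ := hQ.exists_lift (pullback.fst _ _ ≫ yonedaEquiv.symm y)
    (pullback.snd _ _ ≫ yonedaEquiv.symm z)
    (by rw [Category.assoc, hfactor hy, Category.assoc, hfactor hz, hR.w_assoc])
  refine ⟨Subfunctor.range w, Subfunctor.range_isFinite _ w, ?_⟩
  rw [Subfunctor.ofSection_eq_range, Subfunctor.ofSection_eq_range]
  exact preimage_range_inf_preimage_range_le η hQ hR (hfactor hy) (hfactor hz) ha hb

end PullbacksOfSections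

section CoherentObjects

open Opposite

variable {C : Type u} [SmallCategory C] {J : GrothendieckTopology C}

theorem isLocallyFinitelyGenerated_of_isPullback {F X Y Z Q : Cᵒᵖ ⥤ Type u}
    (hJ : IsFiniteTypeTopology J) (hF : PresheafIsQuasiSeparated F) (η : F ⟶ X)
    [Presheaf.IsLocallyInjective J η] (hη : (Subfunctor.range η).sheafify J = ⊤)
    {a : Q ⟶ Y} {b : Q ⟶ Z} {f : Y ⟶ X} {g : Z ⟶ X} (hsq : IsPullback a b f g)
    (hY : IsLocallyFinitelyGenerated J Y) (hZ : IsLocallyFinitelyGenerated J Z) :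
    IsLocallyFinitelyGenerated J Q := by
  have hdense {V : Cᵒᵖ ⥤ Type u} (f : V ⟶ X) :
      ((Subfunctor.range η).preimage f).sheafify J = ⊤ := by
    rw [sheafify_preimage, hη]
    rfl
  obtain ⟨G, hGη, hG, hGtop⟩ := hJ.exists_isFinite_le hY (hdense f)
  obtain ⟨H, hHη, hH, hHtop⟩ := hJ.exists_isFinite_le hZ (hdense g)
  refine isLocallyFinitelyGenerated_of_forall_ofSection a b hGtop hHtop fun c d y hy z hz => ?_
  obtain ⟨u, hu⟩ := hGη _ hy
  obtain ⟨v, hv⟩ := hHη _ hz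
  exact exists_isFinite_preimage_ofSection_inf_le hF η hsq hu hv

theorem isCoherentObject_of_isLocallyInjective_of_sheafify_range_eq_top
    {E : Type w} [Category.{u} E] {U : E ⥤ Cᵒᵖ ⥤ Type u}
    (hU : ∀ Z, U.essImage Z ↔ Presheaf.IsSheaf J Z) [U.Full] [U.Faithful]
    {L : (Cᵒᵖ ⥤ Type u) ⥤ E} (adj : L ⊣ U) (hJ : IsFiniteTypeTopology J)
    {F : Cᵒᵖ ⥤ Type u} (hfin : PresheafIsFinite F) (hF : PresheafIsQuasiSeparated F)
    {X : E} (η : F ⟶ U.obj X) [Presheaf.IsLocallyInjective J η]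
    (hη : (Subfunctor.range η).sheafify J = ⊤) : IsCoherentObject X := by
  have hpres := adj.rightAdjoint_preservesLimits
  refine ⟨?_, fun Q Y Z a b f g hsq hY hZ => ?_⟩
  · exact (isCompactObject_iff hU adj hJ).2
      (isLocallyFinitelyGenerated_of_presheafIsFinite.of_sheafify_range_eq_top hη)
  · rw [isCompactObject_iff hU adj hJ] at hY hZ ⊢
    exact isLocallyFinitelyGenerated_of_isPullback hJ hF η hη (hsq.map U) hY hZ

theorem isCoherentObject_presheaf_iff {F : Cᵒᵖ ⥤ Type u} :
    IsCoherentObject F ↔ PresheafIsFinite F ∧ PresheafIsQuasiSeparated F := by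
  constructor
  · refine fun hF => ⟨isCompactObject_presheaf_iff.1 hF.1, fun c d u v => ?_⟩
    exact isCompactObject_presheaf_iff.1 (hF.2 _ _ _ _ (IsPullback.of_hasPullback u v)
      (isCompactObject_presheaf_iff.2 inferInstance) (isCompactObject_presheaf_iff.2 inferInstance))
  · rintro ⟨hfin, hF⟩
    refine isCoherentObject_of_isLocallyInjective_of_sheafify_range_eq_top
      essImage_id_iff_isSheaf_bot Adjunction.id isFiniteTypeTopology_bot hfin hF (𝟙 F) ?_
    exact (sheafify_bot _).trans (Subfunctor.range_id F)

theorem isCoherentObject_presheafToSheaf (hJ : IsFiniteTypeTopology J) {F : Cᵒᵖ ⥤ Type u}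
    (hF : IsCoherentObject F) : IsCoherentObject ((presheafToSheaf J (Type u)).obj F) := by
  obtain ⟨hfin, hF⟩ := isCoherentObject_presheaf_iff.1 hF
  let adj := sheafificationAdjunction J (Type u)
  exact isCoherentObject_of_isLocallyInjective_of_sheafify_range_eq_top
    essImage_sheafToPresheaf_iff adj hJ hfin hF (toSheafify J F)
    (sheafify_range_unit_eq_top essImage_sheafToPresheaf_iff adj F)

theorem isCoherentObject_yoneda [HasPullbacks C] (c : C) : IsCoherentObject (yoneda.obj c) := by
  refine isCoherentObject_presheaf_iff.2 ⟨inferInstance, fun d e u v => ?_⟩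
  obtain ⟨f, rfl⟩ := yoneda.map_surjective u
  obtain ⟨g, rfl⟩ := yoneda.map_surjective v
  exact presheafIsFinite_of_epi _ (PreservesPullback.iso yoneda f g).hom

end CoherentObjects

section CoherentToposes

open Opposite

theorem EpimorphicFamily.comp_iso_hom_iff {E : Type w} [Category.{v} E] {ι : Type*} {Y : ι → E}
    {X X' : E} (f : ∀ i, Y i ⟶ X) (e : X ≅ X') :
    EpimorphicFamily (fun i => f i ≫ e.hom) ↔ EpimorphicFamily f := by
  refine forall_congr' fun Z => ?_
  simp [e.homFromEquiv.surjective.forall]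

theorem IsCompactObject.of_iso {E : Type w} [Category.{v} E] {X X' : E} (hX : IsCompactObject X)
    (e : X ≅ X') : IsCompactObject X' := by
  intro ι Y f hf
  obtain ⟨s, hs⟩ := hX Y _ ((EpimorphicFamily.comp_iso_hom_iff f e.symm).2 hf)
  exact ⟨s, (EpimorphicFamily.comp_iso_hom_iff (fun i : s => f i) e.symm).1 hs⟩

section SemilatticeInf

variable {P : Type u} [SemilatticeInf P] [OrderTop P]

section EssImage

variable {E : Type w} [Category.{v} E] (G : P ⥤ E) [PreservesFiniteLimits G]

theorem isSubterminal_obj_of_preservesFiniteLimits (p : P) : IsSubterminal (G.obj p) := by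
  have : Mono (homOfLE (le_top : p ≤ ⊤)) := ⟨fun _ _ _ => Subsingleton.elim _ _⟩
  exact fun _ _ _ => (cancel_mono (G.map (homOfLE le_top))).1
    ((IsTerminal.isTerminalObj G ⊤ isTerminalTop).hom_ext _ _)

theorem nonempty_isLimit_map_inf {D : Type} [Fintype D] (p : D → P) :
    Nonempty (IsLimit (Fan.mk (G.obj (Finset.univ.inf p))
      fun d => G.map (homOfLE (Finset.inf_le (Finset.mem_univ d))))) := by
  have hlim : IsLimit (Fan.mk (Finset.univ.inf p)
      fun d => homOfLE (Finset.inf_le (Finset.mem_univ d))) :=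
    Fan.IsLimit.mk _ (fun s => homOfLE (Finset.le_inf fun d _ => leOfHom (s.proj d)))
      (fun _ _ => Subsingleton.elim _ _) (fun _ _ _ => Subsingleton.elim _ _)
  exact ⟨isLimitFanMkObjOfIsLimit G _ _ hlim⟩

theorem isClosedUnderLimitsOfShape_essImage (D : Type) [SmallCategory D] [FinCategory D] :
    G.essImage.IsClosedUnderLimitsOfShape D := by
  refine ⟨?_⟩
  rintro X ⟨pres⟩
  choose p e using pres.prop_diag_obj
  let e d : G.obj (p d) ≅ pres.diag.obj d := (e d).some
  have hsub {Z : E} (d : D) (f g : Z ⟶ pres.diag.obj d) : f = g := by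
    rw [← cancel_mono (e d).inv]
    exact isSubterminal_obj_of_preservesFiniteLimits G _ _ _
  obtain ⟨hlim⟩ := nonempty_isLimit_map_inf G p
  refine ⟨Finset.univ.inf p, ⟨⟨?_, ?_, ?_, ?_⟩⟩⟩
  · exact pres.isLimit.lift ⟨_, ⟨fun d => G.map (homOfLE (Finset.inf_le (Finset.mem_univ d))) ≫
      (e d).hom, fun _ _ _ => hsub _ _ _⟩⟩
  · exact Fan.IsLimit.lift hlim fun d => pres.π.app d ≫ (e d).inv
  · exact isSubterminal_obj_of_preservesFiniteLimits G _ _ _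
  · exact pres.isLimit.hom_ext fun d => hsub d _ _

end EssImage

variable {J : GrothendieckTopology P}

theorem isCoherentTopos_of_isFiniteTypeTopology {E : Type w} [Category.{u} E]
    {U : E ⥤ Pᵒᵖ ⥤ Type u} (hU : ∀ Z, U.essImage Z ↔ Presheaf.IsSheaf J Z) [U.Full] [U.Faithful]
    {L : (Pᵒᵖ ⥤ Type u) ⥤ E} [PreservesFiniteLimits L] (adj : L ⊣ U)
    (hJ : IsFiniteTypeTopology J) : IsCoherentTopos E := by
  refine ⟨(yoneda ⋙ L).essImage, ?_, ?_, fun D _ _ => isClosedUnderLimitsOfShape_essImage _ D⟩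
  · rintro X ⟨p, ⟨e⟩⟩
    exact (isCompactObject_map hU adj hJ isLocallyFinitelyGenerated_of_presheafIsFinite).of_iso e
  · intro X Y f g hfg
    exact epimorphicFamily_homEquiv_symm_sections hU adj X f g fun t =>
      hfg _ ((yoneda ⋙ L).obj_mem_essImage t.1) _

end SemilatticeInf

section FiniteTypeOfCoherent

variable {C : Type u} [SmallCategory C] {J : GrothendieckTopology C}

theorem sheafify_iSup_range_yoneda_map_eq_top_iff {X : C} {ι : Type*} {Y : ι → C}
    (f : ∀ i, Y i ⟶ X) :
    (⨆ i, Subfunctor.range (yoneda.map (f i))).sheafify J = ⊤ ↔ Sieve.ofArrows Y f ∈ J X := by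
  have hmem {d k : C} (a : d ⟶ X) (m : k ⟶ d) :
      (⨆ i, Subfunctor.range (yoneda.map (f i))).sieveOfSection (U := op d) a m ↔
        Sieve.ofArrows Y f (m ≫ a) := by
    simp only [Subfunctor.sieveOfSection_apply, Subfunctor.iSup_obj, Set.mem_iUnion,
      Sieve.mem_ofArrows_iff, eq_comm (a := m ≫ a)]
    rfl
  constructor
  · intro h
    have hid : 𝟙 X ∈ ((⨆ i, Subfunctor.range (yoneda.map (f i))).sheafify J).obj (op X) := by
      rw [h]
      trivial
    exact J.superset_covering (fun k m hm => by simpa using (hmem (𝟙 X) m).1 hm) hid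
  · exact fun h => top_unique fun d a _ =>
      J.superset_covering (fun k m hm => (hmem a m).2 hm) (J.pullback_stable a h)

theorem IsCoherentSubtopos.isFiniteTypeTopology [HasPullbacks C] (h : IsCoherentSubtopos J) :
    IsFiniteTypeTopology J := by
  classical
  intro X R hR
  let f (t : {t : Σ Y, Y ⟶ X // R t.2}) : yoneda.obj t.1.1 ⟶ yoneda.obj X := yoneda.map t.1.2
  have hdense : (⨆ t, Subfunctor.range (f t)).sheafify J = ⊤ :=
    (sheafify_iSup_range_yoneda_map_eq_top_iff _).2 <| J.superset_covering
      (fun Y g hg => Sieve.ofArrows_mk _ _ (⟨⟨Y, g⟩, hg⟩ : {t : Σ Y, Y ⟶ X // R t.2})) hR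
  have hcompact : IsCompactObject ((presheafToSheaf J (Type u)).obj (yoneda.obj X)) :=
    (h.2.2 _ (isCoherentObject_yoneda X)).1
  have adj := sheafificationAdjunction J (Type u)
  obtain ⟨s, hs⟩ := hcompact _ _
    ((epimorphicFamily_map_iff essImage_sheafToPresheaf_iff adj f).2 hdense)
  have hcover : Sieve.ofArrows _ (fun t : s => t.1.1.2) ∈ J X :=
    (sheafify_iSup_range_yoneda_map_eq_top_iff _).1 <|
      (epimorphicFamily_map_iff essImage_sheafToPresheaf_iff adj fun t : s => f t).1 hs
  refine ⟨s.image Subtype.val, sieveOfFinset_le_iff.2 ?_, J.superset_covering ?_ hcover⟩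
  · rintro _ ht
    obtain ⟨t, -, rfl⟩ := Finset.mem_image.1 ht
    exact t.2
  · rw [Sieve.ofArrows, Sieve.generate_le_iff]
    rintro _ _ ⟨t⟩
    exact sieveOfFinset_le_iff.1 le_rfl _ (Finset.mem_image_of_mem _ t.2)

end FiniteTypeOfCoherent

theorem isCoherentSubtopos_iff {P : Type u} [SemilatticeInf P] [OrderTop P]
    {J : GrothendieckTopology P} : IsCoherentSubtopos J ↔ IsFiniteTypeTopology J := by
  refine ⟨fun h => h.isFiniteTypeTopology, fun hJ => ⟨?_, ?_, ?_⟩⟩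
  · exact isCoherentTopos_of_isFiniteTypeTopology essImage_id_iff_isSheaf_bot Adjunction.id
      isFiniteTypeTopology_bot
  · exact isCoherentTopos_of_isFiniteTypeTopology essImage_sheafToPresheaf_iff
      (sheafificationAdjunction J (Type u)) hJ
  · exact fun F hF => isCoherentObject_presheafToSheaf hJ hF

end CoherentToposes

theorem mk_lowerSet_le_mk_isFiniteTypeTopology (P : Type u) [Preorder P] :
    #(LowerSet P) ≤ #{J : GrothendieckTopology P // IsFiniteTypeTopology J} :=
  mk_le_of_injective (f := fun U => ⟨closedTopology U, isFiniteTypeTopology_closedTopology U⟩)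
    fun _ _ h => closedTopology_injective (congrArg Subtype.val h)

theorem mk_isCoherentSubtopos_finSubsetsRev (I : Type u) [Infinite I] :
    #{J : GrothendieckTopology (FinSubsetsRev I) // IsCoherentSubtopos J}
      = (2 : Cardinal.{u}) ^ #(FinSubsetsRev I) := by
  classical
  calc #{J : GrothendieckTopology (FinSubsetsRev I) // IsCoherentSubtopos J}
    _ = #{J : GrothendieckTopology (FinSubsetsRev I) // IsFiniteTypeTopology J} :=
        mk_congr (Equiv.subtypeEquivRight fun _ => isCoherentSubtopos_iff)
    _ = (2 : Cardinal.{u}) ^ #(FinSubsetsRev I) :=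
        (mk_isFiniteTypeTopology_le _).antisymm <| (mk_lowerSet_finSubsetsRev I).ge.trans
          (mk_lowerSet_le_mk_isFiniteTypeTopology _)

theorem mainTheorem8 (I : Type u) [Infinite I] :
    (∃ e : Order.PFilter (FinSubsetsRev I) ≃o Set I,
      ∀ x, e x = {i | ∃ p ∈ x, i ∈ OrderDual.ofDual p}) ∧
    #(Order.PFilter (FinSubsetsRev I)) = (2 : Cardinal.{u}) ^ #(FinSubsetsRev I) ∧
    #{J : GrothendieckTopology (FinSubsetsRev I) // IsClosedSubtopos J}
      = (2 : Cardinal.{u}) ^ #(FinSubsetsRev I) ∧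
    #{J : GrothendieckTopology (FinSubsetsRev I) // IsCoherentSubtopos J}
      = (2 : Cardinal.{u}) ^ #(FinSubsetsRev I) ∧
    #{J : GrothendieckTopology (FinSubsetsRev I) //
        GrothendieckTopology.HasEnoughPoints.{u} J}
      = (2 : Cardinal.{u}) ^ ((2 : Cardinal.{u}) ^ #(FinSubsetsRev I)) ∧
    #(GrothendieckTopology (FinSubsetsRev I))
      = (2 : Cardinal.{u}) ^ ((2 : Cardinal.{u}) ^ #(FinSubsetsRev I)) ∧
    (∃ A : Set (Set I), IsAntichain (· ⊆ ·) A ∧ #A = (2 : Cardinal.{u}) ^ #(FinSubsetsRev I)) ∧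
    (∀ S : Set (Order.PFilter (FinSubsetsRev I)), IsUpperSet S →
      IsClosed[strongTopology (Topology.scott (Order.PFilter (FinSubsetsRev I)) Set.univ)] S) :=
  ⟨⟨pfilterFinSubsetsRevIso I, fun _ => rfl⟩,
    mk_pfilter_finSubsetsRev I,
    by rw [mk_isClosedSubtopos, mk_lowerSet_finSubsetsRev],
    mk_isCoherentSubtopos_finSubsetsRev I,
    mk_hasEnoughPoints_finSubsetsRev I,
    mk_grothendieckTopology_finSubsetsRev I,
    by rw [mk_finSubsetsRev]; exact exists_isAntichain_mk_eq_two_power I,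
    fun _ hS => isClosed_strongTopology_scott_of_isUpperSet hS⟩
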